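/- Let $(\mathbb{X},d)$ be a compact metric space with its Borel $\sigma$-algebra, $\mathbb{U}$ a finite non-empty action set, $\mathcal{T}(\cdot\,|\,x,u)$ a stochastic kernel from $\mathbb{X}\times\mathbb{U}$ to $\mathbb{X}$, $c:\mathbb{X}\times\mathbb{U}\to\mathbb{R}$ a stage-wise cost and $0<\beta<1$. An admissible policy $\gamma=\{\gamma_t\}_{t\ge 0}$ is a sequence of measurable control functions with $U_t=\gamma_t(X_0,\dots,X_t,U_0,\dots,U_{t-1})$. For an initial state $x_0$ put $J_\beta(x_0,\gamma)=E^{\mathcal{T},\gamma}_{x_0}\big[\sum_{t=0}^\infty\beta^t c(X_t,U_t)\big]$ and $J^*_\beta(x_0)=\inf_\gamma J_\beta(x_0,\gamma)$, the infimum being over all admissible policies. Assume that there are constants $\alpha_c,\alpha_T>0$ with $\beta\alpha_T<1$ such that, for all $x,x'\in\mathbb{X}$ and $u\in\mathbb{U}$, $$|c(x,u)-c(x',u)|\le\alpha_c\, d(x,x'),\qquad W_1\big(\mathcal{T}(\cdot|x,u),\mathcal{T}(\cdot|x',u)\big)\le\alpha_T\, d(x,x'),$$ where $W_1$ is the first order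 Wasserstein distance. Let $B_1,\dots,B_M$ be disjoint measurable sets with union $\mathbb{X}$, let $y_i\in B_i$, let $q(x)=y_i$ for $x\in B_i$, let $\pi^*$ be a probability measure on $\mathbb{X}$ with $\pi^*(B_i)>0$ for all $i$, and let $\hat\pi^*_{y_i}(A)=\pi^*(A\cap B_i)/\pi^*(B_i)$. The finite-state model is the Markov decision process with state space $\{y_1,\dots,y_M\}$, action set $\mathbb{U}$, discount factor $\beta$, cost $C^*(y_i,u)=\int_{B_i}c(x,u)\,\hat\pi^*_{y_i}(dx)$ and transition probabilities $P^*(y_j|y_i,u)=\int_{B_i}\mathcal{T}(B_j|x,u)\,\hat\pi^*_{y_i}(dx)$. Let $\hat\gamma$ be any optimal deterministic stationary policy of the finite-state model (one that attains the optimal discounted cost of that model from each of its states), extended to $\mathbb{X}$ by $\hat\gamma(x):=\hat\gamma(q(x))$. Then $$\sup_{x_0\in\mathbb{X}}\left|J_\beta(x_0,\hat\gamma)-J^*_\beta(x_0)\right|\le\frac{2\alpha_c}{(1-\beta)^2(1-\beta\alpha_T)}\,\bar L,\qquad \bar L:=\max_{i=1,\dots,M}\ \sup_{x,x'\in B_i}d(x,x').$$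 -/

import Mathlib

open MeasureTheory ProbabilityTheory

noncomputable section

namespace QuantizedMDP

/-! ### Controlled Markov chains and the discounted cost -/

section ControlledChain

variable {X U : Type*} [MeasurableSpace X] [MeasurableSpace U]

/-- An admissible policy: a sequence of measurable control functions, where the control at time `t`
is a function of the information `(X_0, …, X_t)`, `(U_0, …, U_{t-1})`. -/
structure AdmissiblePolicy (X U : Type*) [MeasurableSpace X] [MeasurableSpace U] where
  /-- the control function `γ_t` -/
  act (t : ℕ) : (Fin (t + 1) → X) × (Fin t → U) → U
  measurable_act (t : ℕ) : Measurable (act t)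

/-- The deterministic stationary policy `U_t = f (X_t)`. -/
def stationary (f : X → U) (hf : Measurable f) : AdmissiblePolicy X U where
  act t I := f (I.1 (Fin.last t))
  measurable_act t := hf.comp ((measurable_pi_apply (Fin.last t)).comp measurable_fst)

/-- The information available at time `t + 1`, when the state-action pairs up to time `t` are `h`
and the state at time `t + 1` is `x`. -/
def nextInfo (t : ℕ) (p : ((i : Finset.Iic t) → X × U) × X) :
    (Fin (t + 1 + 1) → X) × (Fin (t + 1) → U) :=
  (Fin.snoc (α := fun _ => X)
      (fun i : Fin (t + 1) => (p.1 ⟨i, Finset.mem_Iic.2 (Nat.lt_succ_iff.1 i.2)⟩).1) p.2,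
    fun i => (p.1 ⟨i, Finset.mem_Iic.2 (Nat.lt_succ_iff.1 i.2)⟩).2)

lemma measurable_nextInfo (t : ℕ) : Measurable (nextInfo (X := X) (U := U) t) := by
  refine Measurable.prodMk (measurable_pi_iff.2 fun i => ?_) (measurable_pi_iff.2 fun i => ?_)
  · refine Fin.lastCases ?_ (fun j => ?_) i
    · simpa using measurable_snd
    · simp only [Fin.snoc_castSucc]
      exact measurable_fst.comp ((measurable_pi_apply _).comp measurable_fst)
  · exact measurable_snd.comp ((measurable_pi_apply _).comp measurable_fst)

/-- The last state-action pair of a history. -/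
def lastPair (t : ℕ) (h : (i : Finset.Iic t) → X × U) : X × U :=
  h ⟨t, Finset.mem_Iic.2 le_rfl⟩

lemma measurable_lastPair (t : ℕ) : Measurable (lastPair (X := X) (U := U) t) :=
  measurable_pi_apply _

/-- The conditional law of `(X_{t+1}, U_{t+1})` given the state-action pairs up to time `t`:
`X_{t+1}` has law `T(· | X_t, U_t)`, and `U_{t+1} = γ_{t+1}(I_{t+1})`. -/
def stepKernel (T : Kernel (X × U) X) (γ : AdmissiblePolicy X U) (t : ℕ) :
    Kernel ((i : Finset.Iic t) → X × U) (X × U) :=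
  (Kernel.id ×ₖ T.comap (lastPair t) (measurable_lastPair t)).map
    (fun p => (p.2, γ.act (t + 1) (nextInfo t p)))

instance (T : Kernel (X × U) X) [IsMarkovKernel T] (γ : AdmissiblePolicy X U) (t : ℕ) :
    IsMarkovKernel (stepKernel T γ t) :=
  Kernel.IsMarkovKernel.map _
    (measurable_snd.prodMk ((γ.measurable_act (t + 1)).comp (measurable_nextInfo t)))

/-- The law of the state-action process `(X_t, U_t)_{t ≥ 0}` under the policy `γ`, when
`X_0 = x₀` (Ionescu-Tulcea). -/
def pathLaw (T : Kernel (X × U) X) [IsMarkovKernel T] (γ : AdmissiblePolicy X U) (x₀ : X) :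
    Measure (ℕ → X × U) :=
  Kernel.traj (X := fun _ => X × U) (stepKernel T γ) 0
    (fun _ => (x₀, γ.act 0 (fun _ => x₀, Fin.elim0)))

/-- The infinite-horizon discounted expected cost `J_β(x₀, γ) = E[∑ₜ βᵗ c(X_t, U_t)]`. -/
def discountedCost (T : Kernel (X × U) X) [IsMarkovKernel T] (c : X → U → ℝ) (β : ℝ)
    (x₀ : X) (γ : AdmissiblePolicy X U) : ℝ :=
  ∫ ω, ∑' t : ℕ, β ^ t * c (ω t).1 (ω t).2 ∂(pathLaw T γ x₀)

/-- The optimal value function `J*_β(x₀)`: the infimum of the cost over all admissible policies. -/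
def optimalCost (T : Kernel (X × U) X) [IsMarkovKernel T] (c : X → U → ℝ) (β : ℝ) (x₀ : X) : ℝ :=
  ⨅ γ : AdmissiblePolicy X U, discountedCost T c β x₀ γ

/-- A measurable map `f` from states to actions is an optimal (stationary) policy: it attains the
optimal cost from every initial state. -/
def IsOptimalPolicy (T : Kernel (X × U) X) [IsMarkovKernel T] (c : X → U → ℝ) (β : ℝ)
    (f : X → U) (hf : Measurable f) : Prop :=
  ∀ x : X, discountedCost T c β x (stationary f hf) = optimalCost T c β x

end ControlledChain

/-! ### The first order Wasserstein distance -/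

/-- The first order Wasserstein distance: the infimum of `E[d(X, Y)]` over all couplings of
`μ` and `ν`. -/
def wasserstein1 {X : Type*} [MetricSpace X] [MeasurableSpace X] (μ ν : Measure X) : ENNReal :=
  ⨅ ρ : {ρ : Measure (X × X) // ρ.map Prod.fst = μ ∧ ρ.map Prod.snd = ν},
    ∫⁻ p, edist p.1 p.2 ∂ρ.1

/-! ### Quantization of the state space -/

/-- A quantization of `X`: a partition into `M` measurable bins, a representative state in each
bin, and a probability measure that gives positive weight to each bin. -/
structure Quantization (X : Type*) [MeasurableSpace X] (M : ℕ) where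
  bin : Fin M → Set X
  measurableSet_bin : ∀ i, MeasurableSet (bin i)
  disjoint_bin : Pairwise fun i j => Disjoint (bin i) (bin j)
  iUnion_bin : ⋃ i, bin i = Set.univ
  rep : Fin M → X
  rep_mem : ∀ i, rep i ∈ bin i
  weight : Measure X
  isProbabilityMeasure_weight : IsProbabilityMeasure weight
  weight_pos : ∀ i, 0 < weight (bin i)

namespace Quantization

section

variable {X : Type*} [MeasurableSpace X] {M : ℕ} (Q : Quantization X M)

lemma exists_mem_bin (x : X) : ∃ i, x ∈ Q.bin i :=
  Set.mem_iUnion.1 (Q.iUnion_bin ▸ Set.mem_univ x)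

/-- The index of the bin that contains `x`. The finite state space `{y_1, …, y_M}` is identified
with the set of indices; under this identification `index` is the quantizer. -/
def index (x : X) : Fin M := (Q.exists_mem_bin x).choose

/-- The quantizer as a map to representative states: `q x = y_i` for `x` in the `i`-th bin. -/
def q (x : X) : X := Q.rep (Q.index x)

lemma mem_bin_index (x : X) : x ∈ Q.bin (Q.index x) := (Q.exists_mem_bin x).choose_spec

lemma index_eq_iff (x : X) (i : Fin M) : Q.index x = i ↔ x ∈ Q.bin i := by
  refine ⟨fun h => h ▸ Q.mem_bin_index x, fun h => ?_⟩
  by_contra hne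
  exact Set.disjoint_left.1 (Q.disjoint_bin hne) (Q.mem_bin_index x) h

lemma measurable_index : Measurable Q.index :=
  measurable_to_countable' fun i => by
    have : Q.index ⁻¹' {i} = Q.bin i := Set.ext fun x => Q.index_eq_iff x i
    exact this ▸ Q.measurableSet_bin i

/-- The weighting measure, normalized on the `i`-th bin. -/
def binMeasure (i : Fin M) : Measure X := cond Q.weight (Q.bin i)

instance (i : Fin M) : IsProbabilityMeasure (Q.binMeasure i) :=
  have := Q.isProbabilityMeasure_weight
  cond_isProbabilityMeasure (Q.weight_pos i).ne'

variable {U : Type*}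

/-- The stage-wise cost of the finite-state model. -/
def finiteCost (c : X → U → ℝ) (i : Fin M) (u : U) : ℝ :=
  ∫ x, c x u ∂(Q.binMeasure i)

variable [MeasurableSpace U]

/-- The transition probability from `i` to `j` under the action `u` in the finite-state model. -/
def finiteProb (T : Kernel (X × U) X) (i : Fin M) (u : U) (j : Fin M) : ENNReal :=
  ∫⁻ x, T (x, u) (Q.bin j) ∂(Q.binMeasure i)

/-- The transition kernel of the finite-state model. -/
def finiteKernel [Finite U] [MeasurableSingletonClass U] (T : Kernel (X × U) X) :
    Kernel (Fin M × U) (Fin M) where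
  toFun p := ∑ j, Q.finiteProb T p.1 p.2 j • Measure.dirac j
  measurable' := measurable_of_countable _

instance [Finite U] [MeasurableSingletonClass U] (T : Kernel (X × U) X) [IsMarkovKernel T] :
    IsMarkovKernel (Q.finiteKernel T) where
  isProbabilityMeasure p := ⟨by
    have hmeas : ∀ j, Measurable fun x => T (x, p.2) (Q.bin j) := fun j =>
      (T.measurable_coe (Q.measurableSet_bin j)).comp measurable_prodMk_right
    have hsum : ∀ x, ∑ j, T (x, p.2) (Q.bin j) = 1 := fun x => by
      rw [← measure_univ (μ := T (x, p.2)), ← Q.iUnion_bin,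
        measure_iUnion Q.disjoint_bin Q.measurableSet_bin, tsum_fintype]
    have h1 : ∑ j, Q.finiteProb T p.1 p.2 j = 1 := by
      simp only [finiteProb]
      rw [← lintegral_finsetSum _ fun j _ => hmeas j]
      simp [hsum]
    change (∑ j, Q.finiteProb T p.1 p.2 j • Measure.dirac j) Set.univ = 1
    simpa [Measure.finsetSum_apply] using h1⟩

/-- The policy `f` of the finite-state model, extended to `X` so as to be constant on each bin. -/
def extend (f : Fin M → U) : AdmissiblePolicy X U :=
  stationary (fun x => f (Q.index x)) ((measurable_of_countable f).comp Q.measurable_index)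

end

/-- The largest diameter of a bin. -/
def maxDiam {X : Type*} [MetricSpace X] [MeasurableSpace X] {M : ℕ} (Q : Quantization X M) : ℝ :=
  ⨆ i, Metric.diam (Q.bin i)

end Quantization

end QuantizedMDP

end

/-!
Write `K = αc / (1 - β αT)`, so that `αc + β αT K = K`, and `L` for the largest bin diameter.

Everything about infinite horizons is contained in one identity, `hasSum_bellmanGap`: for a bounded
measurable `v` and any admissible policy, the cost minus `v x₀` is the expected discounted sum of the
gaps `c(x, u) + β ∫ v dT(· | x, u) - v x` along the trajectory. It follows by telescoping, since
`X_{t+1}` has conditional law `T(· | X_t, U_t)` under every policy. If all gaps are non-negative,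
then `v` is a lower bound for all costs; if a stationary policy has gaps at most `δ`, then its cost
is at most `v + δ / (1 - β)`.

Let `v` solve the Bellman equation of the original model. The Bellman operator preserves `K`-Lipschitz
functions, because averaging a `K`-Lipschitz function against `T(· | x, u)` is `K αT`-Lipschitz in
`x`; hence `v` can be taken `K`-Lipschitz (`exists_lipschitz_bellman_solution`). Let `g` solve the
Bellman equation of the finite-state model and `e = sup |g ∘ index - v|`. The lookahead costs of the
finite-state model are averages over a bin of lookahead costs of the original model with `g ∘ index`
in place of `v`, so the two differ by at most `K L + β e` (`Quantization.abs_finite_lookahead_sub_le`).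
Taking minima over the actions, `e ≤ K L + β e`.

An optimal policy of the finite-state model takes actions that are greedy for `g`
(`IsOptimalPolicy.eq_lookahead`), so the gaps of `v` under its extension are at most
`K L + β e + e ≤ 2 K L / (1 - β)`. The cost of the extension therefore exceeds `v`, a lower bound for
the optimal cost, by at most `2 K L / (1 - β) ^ 2`.
-/

open MeasureTheory ProbabilityTheory

namespace QuantizedMDP

/-! ### One-step laws of the state-action process -/

section
variable {X U : Type*} [MeasurableSpace X] [MeasurableSpace U]

instance (T : Kernel (X × U) X) [IsMarkovKernel T] (γ : AdmissiblePolicy X U) (x₀ : X) :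
    IsProbabilityMeasure (pathLaw T γ x₀) := by
  unfold pathLaw
  infer_instance

lemma pathLaw_map_eval_zero (T : Kernel (X × U) X) [IsMarkovKernel T] (γ : AdmissiblePolicy X U)
    (x₀ : X) :
    (pathLaw T γ x₀).map (fun ω => ω 0)
      = Measure.dirac (x₀, γ.act 0 (fun _ => x₀, Fin.elim0)) := by
  have h : (fun ω : ℕ → X × U => ω 0) = lastPair 0 ∘ Preorder.frestrictLe 0 := rfl
  rw [h, ← Measure.map_map (measurable_lastPair 0) (Preorder.measurable_frestrictLe 0), pathLaw,
    Kernel.traj_map_frestrictLe_apply, Kernel.partialTraj_self, Kernel.id_apply,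
    Measure.map_dirac' (measurable_lastPair 0)]
  rfl

/-- The one-step law of the path measure: given the history up to time `t`, the next state-action
pair has law `stepKernel T γ t`. -/
lemma pathLaw_map_eval_succ (T : Kernel (X × U) X) [IsMarkovKernel T] (γ : AdmissiblePolicy X U)
    (x₀ : X) (t : ℕ) :
    (pathLaw T γ x₀).map (fun ω => ω (t + 1))
      = ((pathLaw T γ x₀).map (Preorder.frestrictLe t)).bind (stepKernel T γ t) := by
  have h : (fun ω : ℕ → X × U => ω (t + 1)) = lastPair (t + 1) ∘ Preorder.frestrictLe (t + 1) := rfl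
  rw [h, ← Measure.map_map (measurable_lastPair _) (Preorder.measurable_frestrictLe _), pathLaw,
    Kernel.traj_map_frestrictLe_apply, Kernel.traj_map_frestrictLe_apply,
    Kernel.partialTraj_succ_eq_comp (Nat.zero_le t), ← Kernel.map_apply _ (measurable_lastPair _),
    Kernel.map_comp, Kernel.comp_apply]
  have hk : (Kernel.partialTraj (X := fun _ => X × U) (stepKernel T γ) t (t + 1)).map
      (lastPair (t + 1)) = stepKernel T γ t := Kernel.map_partialTraj_succ_self t
  rw [hk]

/-- Whatever the policy, the state at time `t + 1` is drawn from `T (· | X_t, U_t)`. -/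
lemma pathLaw_map_state_succ (T : Kernel (X × U) X) [IsMarkovKernel T] (γ : AdmissiblePolicy X U)
    (x₀ : X) (t : ℕ) :
    (pathLaw T γ x₀).map (fun ω => (ω (t + 1)).1)
      = ((pathLaw T γ x₀).map (fun ω => ω t)).bind T := by
  have h1 : (fun ω : ℕ → X × U => (ω (t + 1)).1) = Prod.fst ∘ (fun ω => ω (t + 1)) := rfl
  have h2 : (fun ω : ℕ → X × U => ω t) = lastPair t ∘ Preorder.frestrictLe t := rfl
  have hm : Measurable fun p : ((i : Finset.Iic t) → X × U) × X =>
      (p.2, γ.act (t + 1) (nextInfo t p)) :=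
    measurable_snd.prodMk ((γ.measurable_act (t + 1)).comp (measurable_nextInfo t))
  rw [h1, ← Measure.map_map measurable_fst (measurable_pi_apply _), pathLaw_map_eval_succ, h2,
    ← Measure.map_map (measurable_lastPair _) (Preorder.measurable_frestrictLe _)]
  set μ := (pathLaw T γ x₀).map (Preorder.frestrictLe t)
  have hk : (stepKernel T γ t).map Prod.fst = T.comap (lastPair t) (measurable_lastPair t) := by
    rw [stepKernel, ← Kernel.map_comp_right _ hm measurable_fst]
    have hc : (Prod.fst ∘ fun p : ((i : Finset.Iic t) → X × U) × X =>
        (p.2, γ.act (t + 1) (nextInfo t p))) = Prod.snd := rfl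
    rw [hc, ← Kernel.snd_eq]
    exact Kernel.snd_prod Kernel.id (T.comap (lastPair t) (measurable_lastPair t))
  rw [Measure.map_comp _ _ measurable_fst, hk]
  ext s hs
  rw [Measure.bind_apply hs (Kernel.aemeasurable _), Measure.bind_apply hs (Kernel.aemeasurable _),
    lintegral_map (T.measurable_coe hs) (measurable_lastPair t)]
  rfl

/-- Under a stationary policy, `U_t = f (X_t)` almost surely. -/
lemma ae_pathLaw_stationary [MeasurableEq U] (T : Kernel (X × U) X) [IsMarkovKernel T]
    {f : X → U} (hf : Measurable f) (x₀ : X) (t : ℕ) :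
    ∀ᵐ ω ∂(pathLaw T (stationary f hf) x₀), (ω t).2 = f (ω t).1 := by
  have hs : MeasurableSet {p : X × U | p.2 = f p.1} :=
    measurableSet_eq_fun measurable_snd (hf.comp measurable_fst)
  suffices h : ∀ᵐ p ∂((pathLaw T (stationary f hf) x₀).map fun ω => ω t), p.2 = f p.1 from
    ae_of_ae_map (measurable_pi_apply t).aemeasurable h
  cases t with
  | zero =>
    rw [pathLaw_map_eval_zero, ae_dirac_iff hs]
    rfl
  | succ t =>
    have hm : Measurable fun p : ((i : Finset.Iic t) → X × U) × X =>
        (p.2, (stationary f hf).act (t + 1) (nextInfo t p)) :=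
      measurable_snd.prodMk
        (((stationary f hf).measurable_act (t + 1)).comp (measurable_nextInfo t))
    rw [pathLaw_map_eval_succ]
    refine Measure.ae_comp_of_ae_ae hs (Filter.Eventually.of_forall fun h => ?_)
    rw [stepKernel, Kernel.map_apply _ hm, ae_map_iff hm.aemeasurable hs]
    refine Filter.Eventually.of_forall fun p => ?_
    simp [stationary, nextInfo]

end

lemma integral_bind_kernel {α δ : Type*} [MeasurableSpace α] [MeasurableSpace δ] (μ : Measure α)
    (κ : Kernel α δ) {f : δ → ℝ} (hf : Integrable f (μ.bind κ)) :
    ∫ y, f y ∂(μ.bind κ) = ∫ x, ∫ y, f y ∂κ x ∂μ := by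
  have h := Kernel.integral_comp (a := ()) (κ := Kernel.const Unit μ) (η := κ) (f := f)
    (by simpa [Kernel.comp_apply] using hf)
  simpa [Kernel.comp_apply] using h

lemma integrable_of_measurable_of_bound {α : Type*} [MeasurableSpace α] (μ : Measure α)
    [IsFiniteMeasure μ] {f : α → ℝ} (hf : Measurable f) {C : ℝ} (hC : ∀ x, |f x| ≤ C) :
    Integrable f μ :=
  Integrable.of_bound hf.aestronglyMeasurable C (Filter.Eventually.of_forall hC)

lemma abs_integral_le_of_bound {α : Type*} [MeasurableSpace α] (μ : Measure α)
    [IsProbabilityMeasure μ] {f : α → ℝ} {C : ℝ} (hC : ∀ x, |f x| ≤ C) : |∫ x, f x ∂μ| ≤ C := by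
  simpa using norm_integral_le_of_norm_le_const (μ := μ) (f := f) (C := C)
    (Filter.Eventually.of_forall hC)

/-! ### The performance difference identity and its consequences -/

section
variable {X U : Type*} [MeasurableSpace X] [MeasurableSpace U]

/-- The Bellman gap of `v` at a state-action pair: the excess of the one-step lookahead cost
`c(x, u) + β ∫ v dT(· | x, u)` over `v x`. -/
noncomputable def bellmanGap (T : Kernel (X × U) X) (c : X → U → ℝ) (β : ℝ) (v : X → ℝ)
    (p : X × U) : ℝ :=
  c p.1 p.2 + β * ∫ y, v y ∂T p - v p.1

lemma hasSum_discounted_integral (P : Measure (ℕ → X × U)) [IsProbabilityMeasure P] {β : ℝ}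
    (hβ0 : 0 ≤ β) (hβ1 : β < 1) {g : X × U → ℝ} (hg : Measurable g) {C : ℝ}
    (hC : ∀ p, |g p| ≤ C) :
    HasSum (fun t : ℕ => β ^ t * ∫ ω, g (ω t) ∂P) (∫ ω, ∑' t : ℕ, β ^ t * g (ω t) ∂P) := by
  have hint : ∀ t : ℕ, Integrable (fun ω : ℕ → X × U => g (ω t)) P := fun t =>
    integrable_of_measurable_of_bound P (hg.comp (measurable_pi_apply t)) fun ω => hC (ω t)
  have h := hasSum_integral_of_summable_integral_norm (μ := P)
    (F := fun (t : ℕ) (ω : ℕ → X × U) => β ^ t * g (ω t)) (fun t => (hint t).const_mul _) ?_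
  · simpa only [integral_const_mul] using h
  · refine Summable.of_norm_bounded
      ((summable_geometric_of_lt_one hβ0 hβ1).mul_right C) fun t => ?_
    refine abs_integral_le_of_bound P fun ω => ?_
    rw [abs_norm, norm_mul, norm_pow, Real.norm_of_nonneg hβ0]
    exact mul_le_mul_of_nonneg_left (hC _) (pow_nonneg hβ0 t)

/-- The performance difference identity: the cost of any policy exceeds `v x₀` by the expected
discounted sum of the Bellman gaps of `v` along the trajectory. -/
lemma hasSum_bellmanGap (T : Kernel (X × U) X) [IsMarkovKernel T] {c : X → U → ℝ} {β : ℝ}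
    (hβ0 : 0 ≤ β) (hβ1 : β < 1) (hcm : Measurable (Function.uncurry c)) {C : ℝ}
    (hcb : ∀ x u, |c x u| ≤ C) {v : X → ℝ} (hv : Measurable v) {B : ℝ} (hvb : ∀ x, |v x| ≤ B)
    (γ : AdmissiblePolicy X U) (x₀ : X) :
    HasSum (fun t : ℕ => β ^ t * ∫ ω, bellmanGap T c β v (ω t) ∂(pathLaw T γ x₀))
      (discountedCost T c β x₀ γ - v x₀) := by
  set P := pathLaw T γ x₀ with hP
  have hint : ∀ (g : X × U → ℝ) (K : ℝ) (_ : Measurable g) (_ : ∀ p, |g p| ≤ K) (t : ℕ),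
      Integrable (fun ω : ℕ → X × U => g (ω t)) P := fun g K hg hK t =>
    integrable_of_measurable_of_bound P (hg.comp (measurable_pi_apply t)) fun ω => hK (ω t)
  have hTm : Measurable fun p => ∫ y, v y ∂T p := hv.stronglyMeasurable.integral_kernel.measurable
  have hTb : ∀ p, |∫ y, v y ∂T p| ≤ B := fun p => abs_integral_le_of_bound _ hvb
  have hc := hasSum_discounted_integral P hβ0 hβ1 hcm (fun p => hcb p.1 p.2)
  have hb := hasSum_discounted_integral P hβ0 hβ1 (hv.comp measurable_fst) (fun p => hvb p.1)
  have hb' := (hasSum_nat_add_iff' 1).2 hb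
  have h0 : ∫ ω, v (ω 0).1 ∂P = v x₀ := by
    have : ∫ ω, v (ω 0).1 ∂P = ∫ p, v p.1 ∂(P.map fun ω => ω 0) :=
      (integral_map (f := fun p : X × U => v p.1)
        (measurable_pi_apply (X := fun _ : ℕ => X × U) 0).aemeasurable
        (hv.comp measurable_fst).aestronglyMeasurable).symm
    rw [this, hP, pathLaw_map_eval_zero]
    exact integral_dirac' _ _ (hv.comp measurable_fst).stronglyMeasurable
  have hsucc : ∀ t, ∫ ω, v (ω (t + 1)).1 ∂P = ∫ ω, ∫ y, v y ∂T (ω t) ∂P := by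
    intro t
    have : ∫ ω, v (ω (t + 1)).1 ∂P = ∫ x, v x ∂(P.map fun ω => (ω (t + 1)).1) :=
      (integral_map (measurable_fst.comp (measurable_pi_apply (t + 1))).aemeasurable
        hv.aestronglyMeasurable).symm
    rw [this, hP, pathLaw_map_state_succ, integral_bind_kernel,
      integral_map (measurable_pi_apply t).aemeasurable hTm.aestronglyMeasurable]
    rw [← pathLaw_map_state_succ]
    exact integrable_of_measurable_of_bound _ hv hvb
  have hgap : ∀ t, ∫ ω, bellmanGap T c β v (ω t) ∂P
      = ∫ ω, c (ω t).1 (ω t).2 ∂P + β * ∫ ω, v (ω (t + 1)).1 ∂P - ∫ ω, v (ω t).1 ∂P := by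
    intro t
    have i1 := hint _ C hcm (fun p => hcb p.1 p.2) t
    have i2 := (hint _ B hTm hTb t).const_mul β
    have i3 := hint _ B (hv.comp measurable_fst) (fun p => hvb p.1) t
    rw [hsucc, ← integral_const_mul]
    exact (integral_sub (i1.add i2) i3).trans (congrArg (· - _) (integral_add i1 i2))
  have hJ : ∫ ω, ∑' t : ℕ, β ^ t * Function.uncurry c (ω t) ∂P = discountedCost T c β x₀ γ := rfl
  rw [hJ] at hc
  have h := (hc.add hb').sub hb
  have hsum : discountedCost T c β x₀ γ - v x₀ = discountedCost T c β x₀ γ +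
      (∫ ω, ∑' t : ℕ, β ^ t * (v ∘ Prod.fst) (ω t) ∂P -
        ∑ i ∈ Finset.range 1, β ^ i * ∫ ω, (v ∘ Prod.fst) (ω i) ∂P) -
      ∫ ω, ∑' t : ℕ, β ^ t * (v ∘ Prod.fst) (ω t) ∂P := by
    simp only [Finset.range_one, Finset.sum_singleton, pow_zero, one_mul, Function.comp_apply, h0]
    ring
  rw [hsum]
  refine h.congr_fun fun t => ?_
  rw [hgap]
  simp only [Function.uncurry_def, Function.comp]
  ring

/-- A subsolution of the Bellman equation bounds the cost of every admissible policy from below. -/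
lemma le_discountedCost_of_bellmanGap_nonneg (T : Kernel (X × U) X) [IsMarkovKernel T]
    {c : X → U → ℝ} {β : ℝ} (hβ0 : 0 ≤ β) (hβ1 : β < 1) (hcm : Measurable (Function.uncurry c))
    {C : ℝ} (hcb : ∀ x u, |c x u| ≤ C) {v : X → ℝ} (hv : Measurable v) {B : ℝ}
    (hvb : ∀ x, |v x| ≤ B) (hgap : ∀ p, 0 ≤ bellmanGap T c β v p)
    (γ : AdmissiblePolicy X U) (x₀ : X) : v x₀ ≤ discountedCost T c β x₀ γ := by
  have h := hasSum_bellmanGap T hβ0 hβ1 hcm hcb hv hvb γ x₀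
  have hterm : ∀ t : ℕ, 0 ≤ β ^ t * ∫ ω, bellmanGap T c β v (ω t) ∂(pathLaw T γ x₀) := fun t =>
    mul_nonneg (pow_nonneg hβ0 t) (integral_nonneg fun ω => hgap (ω t))
  exact sub_nonneg.1 (h.nonneg hterm)

/-- A stationary policy whose one-step lookahead costs exceed `v` by at most `δ` has total cost
at most `v + δ / (1 - β)`. -/
lemma discountedCost_stationary_le [MeasurableEq U] (T : Kernel (X × U) X) [IsMarkovKernel T]
    {c : X → U → ℝ} {β : ℝ} (hβ0 : 0 ≤ β) (hβ1 : β < 1) (hcm : Measurable (Function.uncurry c))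
    {C : ℝ} (hcb : ∀ x u, |c x u| ≤ C) {v : X → ℝ} (hv : Measurable v) {B : ℝ}
    (hvb : ∀ x, |v x| ≤ B) {f : X → U} (hf : Measurable f) {δ : ℝ} (hδ : 0 ≤ δ)
    (hgap : ∀ x, bellmanGap T c β v (x, f x) ≤ δ) (x₀ : X) :
    discountedCost T c β x₀ (stationary f hf) ≤ v x₀ + δ / (1 - β) := by
  have h := hasSum_bellmanGap T hβ0 hβ1 hcm hcb hv hvb (stationary f hf) x₀
  have hg := (hasSum_geometric_of_lt_one hβ0 hβ1).mul_right δ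
  have hterm : ∀ t, ∫ ω, bellmanGap T c β v (ω t) ∂(pathLaw T (stationary f hf) x₀) ≤ δ := by
    intro t
    have hae : ∀ᵐ ω ∂(pathLaw T (stationary f hf) x₀), bellmanGap T c β v (ω t) ≤ δ := by
      filter_upwards [ae_pathLaw_stationary T hf x₀ t] with ω hω
      have : ω t = ((ω t).1, f (ω t).1) := Prod.ext rfl hω
      rw [this]
      exact hgap _
    -- a gap that is not integrable has integral `0 ≤ δ`
    by_cases hi : Integrable (fun ω => bellmanGap T c β v (ω t)) (pathLaw T (stationary f hf) x₀)
    · simpa using integral_mono_ae hi (integrable_const δ) hae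
    · rwa [integral_undef hi]
  have hle : discountedCost T c β x₀ (stationary f hf) - v x₀ ≤ (1 - β)⁻¹ * δ :=
    hasSum_le (fun t => mul_le_mul_of_nonneg_left (hterm t) (pow_nonneg hβ0 t)) h hg
  rw [inv_mul_eq_div] at hle
  linarith

/-- If `v` is a subsolution of the Bellman equation and a stationary policy attains `v x₀`, then
its first action is greedy for `v`: the first term of the performance difference must vanish. -/
lemma bellmanGap_nonpos_of_discountedCost_le (T : Kernel (X × U) X) [IsMarkovKernel T]
    {c : X → U → ℝ} {β : ℝ} (hβ0 : 0 ≤ β) (hβ1 : β < 1) (hcm : Measurable (Function.uncurry c))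
    {C : ℝ} (hcb : ∀ x u, |c x u| ≤ C) {v : X → ℝ} (hv : Measurable v) {B : ℝ}
    (hvb : ∀ x, |v x| ≤ B) (hgap : ∀ p, 0 ≤ bellmanGap T c β v p) {f : X → U} (hf : Measurable f)
    {x₀ : X} (hx₀ : discountedCost T c β x₀ (stationary f hf) ≤ v x₀) :
    bellmanGap T c β v (x₀, f x₀) ≤ 0 := by
  have h := hasSum_bellmanGap T hβ0 hβ1 hcm hcb hv hvb (stationary f hf) x₀
  have h0 := le_hasSum h 0 fun t _ =>
    mul_nonneg (pow_nonneg hβ0 t) (integral_nonneg fun ω => hgap (ω t))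
  have hm : Measurable (bellmanGap T c β v) :=
    (hcm.add (hv.stronglyMeasurable.integral_kernel.measurable.const_mul β)).sub
      (hv.comp measurable_fst)
  have hfirst : ∫ ω, bellmanGap T c β v (ω 0) ∂(pathLaw T (stationary f hf) x₀)
      = bellmanGap T c β v (x₀, f x₀) := by
    rw [← integral_map (measurable_pi_apply (X := fun _ : ℕ => X × U) 0).aemeasurable
      hm.aestronglyMeasurable, pathLaw_map_eval_zero]
    exact integral_dirac' _ _ hm.stronglyMeasurable
  rw [hfirst, pow_zero, one_mul] at h0
  linarith

end

/-! ### Solutions of the Bellman equation -/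

lemma abs_iInf_sub_iInf_le {ι : Type*} [Finite ι] [Nonempty ι] {f g : ι → ℝ} {ε : ℝ}
    (h : ∀ i, |f i - g i| ≤ ε) : |(⨅ i, f i) - ⨅ i, g i| ≤ ε := by
  obtain ⟨i, hi⟩ := exists_eq_ciInf_of_finite (f := f)
  obtain ⟨j, hj⟩ := exists_eq_ciInf_of_finite (f := g)
  have h1 : ⨅ i, f i ≤ f j := ciInf_le (Set.finite_range f).bddBelow j
  have h2 : ⨅ i, g i ≤ g i := ciInf_le (Set.finite_range g).bddBelow i
  have h3 := abs_le.1 (h i)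
  have h4 := abs_le.1 (h j)
  rw [abs_le]
  constructor <;> linarith

open scoped BoundedContinuousFunction

/-- The Bellman operator is a `β`-contraction for the uniform norm, so it has a fixed point in every
non-empty closed set of bounded continuous functions that it maps to itself. -/
lemma exists_bellman_fixedPoint {S U : Type*} [TopologicalSpace S] [MeasurableSpace S]
    [OpensMeasurableSpace S] [MeasurableSpace U] [Finite U] [Nonempty U]
    (T : Kernel (S × U) S) [IsMarkovKernel T] (c : S → U → ℝ) {β : ℝ} (hβ0 : 0 ≤ β) (hβ1 : β < 1)
    {A : Set (S →ᵇ ℝ)} (hA : IsClosed A) (hne : A.Nonempty)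
    (hmap : ∀ f ∈ A, ∃ g ∈ A, ∀ x, g x = ⨅ u, (c x u + β * ∫ y, f y ∂T (x, u))) :
    ∃ v ∈ A, ∀ x, v x = ⨅ u, (c x u + β * ∫ y, v y ∂T (x, u)) := by
  choose! Φ hΦA hΦ using hmap
  have := hne.to_subtype
  have := hA.completeSpace_coe
  let Ψ : A → A := fun f => ⟨Φ f, hΦA f f.2⟩
  have hΨ : ContractingWith ⟨β, hβ0⟩ Ψ := by
    refine ⟨hβ1, LipschitzWith.of_dist_le_mul fun f g => ?_⟩
    change dist (Φ f) (Φ g) ≤ β * dist (f : S →ᵇ ℝ) g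
    refine (BoundedContinuousFunction.dist_le (by positivity)).2 fun x => ?_
    rw [hΦ f f.2, hΦ g g.2, Real.dist_eq]
    refine abs_iInf_sub_iInf_le fun u => ?_
    have hi : ∀ h : S →ᵇ ℝ, Integrable h (T (x, u)) := fun h => h.integrable _
    rw [add_sub_add_left_eq_sub, ← mul_sub, ← integral_sub (hi f) (hi g), abs_mul,
      abs_of_nonneg hβ0]
    exact mul_le_mul_of_nonneg_left (abs_integral_le_of_bound _ fun y =>
      (f : S →ᵇ ℝ).dist_coe_le_dist (g := g) y) hβ0
  obtain ⟨v, hv⟩ : ∃ v : A, Ψ v = v := ⟨_, hΨ.fixedPoint_isFixedPt⟩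
  refine ⟨v, v.2, fun x => ?_⟩
  rw [← hΦ v v.2, show Φ v = (v : S →ᵇ ℝ) from congrArg Subtype.val hv]

/-- The easy half of Kantorovich duality. -/
lemma abs_integral_sub_integral_le_of_wasserstein1_le {X : Type*} [MetricSpace X]
    [MeasurableSpace X] [OpensMeasurableSpace X] {μ ν : Measure X} [IsFiniteMeasure μ]
    {r : ℝ} (hr : 0 ≤ r) (hW : wasserstein1 μ ν ≤ ENNReal.ofReal r) {K : ℝ} (hK : 0 < K)
    {v : X → ℝ} (hvb : ∃ B, ∀ x, |v x| ≤ B) (hv : ∀ x y, |v x - v y| ≤ K * dist x y) :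
    |∫ x, v x ∂μ - ∫ x, v x ∂ν| ≤ K * r := by
  obtain ⟨B, hB⟩ := hvb
  have hvc : Continuous v := (LipschitzWith.of_dist_le_mul (K := ⟨K, hK.le⟩) hv).continuous
  suffices h : ENNReal.ofReal |∫ x, v x ∂μ - ∫ x, v x ∂ν|
      ≤ ENNReal.ofReal K * wasserstein1 μ ν by
    have h2 := h.trans (mul_le_mul_right hW _)
    rw [← ENNReal.ofReal_mul hK.le] at h2
    exact (ENNReal.ofReal_le_ofReal_iff (by positivity)).1 h2
  rw [wasserstein1, ENNReal.mul_iInf_of_ne (by simpa using hK) ENNReal.ofReal_ne_top]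
  refine le_iInf fun ⟨ρ, hρ₁, hρ₂⟩ => ?_
  have hρ : IsFiniteMeasure ρ := by
    have : IsFiniteMeasure (ρ.map Prod.fst) := hρ₁ ▸ inferInstance
    exact Measure.isFiniteMeasure_of_map measurable_fst.aemeasurable
  have e₁ : ∫ x, v x ∂μ = ∫ p, v p.1 ∂ρ := by
    rw [← hρ₁, integral_map measurable_fst.aemeasurable hvc.measurable.aestronglyMeasurable]
  have e₂ : ∫ x, v x ∂ν = ∫ p, v p.2 ∂ρ := by
    rw [← hρ₂, integral_map measurable_snd.aemeasurable hvc.measurable.aestronglyMeasurable]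
  have i₁ : Integrable (fun p : X × X => v p.1) ρ :=
    integrable_of_measurable_of_bound ρ (hvc.measurable.comp measurable_fst) fun p => hB p.1
  have i₂ : Integrable (fun p : X × X => v p.2) ρ :=
    integrable_of_measurable_of_bound ρ (hvc.measurable.comp measurable_snd) fun p => hB p.2
  rw [e₁, e₂, ← integral_sub i₁ i₂, ← Real.enorm_eq_ofReal_abs]
  refine (enorm_integral_le_lintegral_enorm _).trans ?_
  rw [← lintegral_const_mul' _ _ ENNReal.ofReal_ne_top]
  refine lintegral_mono fun p => ?_
  rw [Real.enorm_eq_ofReal_abs, edist_dist, ← ENNReal.ofReal_mul hK.le]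
  exact ENNReal.ofReal_le_ofReal (hv p.1 p.2)

/-- Under Lipschitz costs and Wasserstein-Lipschitz transitions the Bellman equation has a
Lipschitz solution. The constant `K` is determined by `αc + β * αT * K = K`. -/
lemma exists_lipschitz_bellman_solution {X U : Type*} [MetricSpace X] [CompactSpace X]
    [MeasurableSpace X] [BorelSpace X] [Finite U] [Nonempty U] [MeasurableSpace U]
    (T : Kernel (X × U) X) [IsMarkovKernel T] {c : X → U → ℝ} {β αc αT K : ℝ} (hβ0 : 0 ≤ β)
    (hβ1 : β < 1) (hαT : 0 ≤ αT) (hK : 0 < K) (hKeq : αc + β * αT * K = K)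
    (hc : ∀ (x x' : X) (u : U), |c x u - c x' u| ≤ αc * dist x x')
    (hT : ∀ (x x' : X) (u : U),
      wasserstein1 (T (x, u)) (T (x', u)) ≤ ENNReal.ofReal (αT * dist x x')) :
    ∃ v : X →ᵇ ℝ, (∀ x y, |v x - v y| ≤ K * dist x y) ∧
      ∀ x, v x = ⨅ u, (c x u + β * ∫ y, v y ∂T (x, u)) := by
  have hA : IsClosed {f : X →ᵇ ℝ | ∀ x y, |f x - f y| ≤ K * dist x y} := by
    simp only [Set.ofPred_forall]
    refine isClosed_iInter fun x => isClosed_iInter fun y => isClosed_le ?_ continuous_const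
    exact ((continuous_eval_const x).sub
      (continuous_eval_const y)).abs
  refine exists_bellman_fixedPoint T c hβ0 hβ1 hA
    ⟨0, fun x y => by simpa using mul_nonneg hK.le dist_nonneg⟩ fun f hf => ?_
  have hg : ∀ x y, |(⨅ u, (c x u + β * ∫ z, f z ∂T (x, u)))
      - ⨅ u, (c y u + β * ∫ z, f z ∂T (y, u))| ≤ K * dist x y := by
    intro x y
    refine abs_iInf_sub_iInf_le fun u => ?_
    have h1 := abs_integral_sub_integral_le_of_wasserstein1_le
      (mul_nonneg hαT dist_nonneg) (hT x y u) hK ⟨‖f‖, f.norm_coe_le_norm⟩ hf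
    calc |c x u + β * ∫ z, f z ∂T (x, u) - (c y u + β * ∫ z, f z ∂T (y, u))|
        = |(c x u - c y u) + β * (∫ z, f z ∂T (x, u) - ∫ z, f z ∂T (y, u))| := by
          congr 1; ring
      _ ≤ |c x u - c y u| + β * |∫ z, f z ∂T (x, u) - ∫ z, f z ∂T (y, u)| := by
          rw [← abs_of_nonneg hβ0, ← abs_mul, abs_of_nonneg hβ0]
          exact abs_add_le _ _
      _ ≤ αc * dist x y + β * (K * (αT * dist x y)) := by
          gcongr
          exact hc x y u
      _ = (αc + β * αT * K) * dist x y := by ring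
      _ = K * dist x y := by rw [hKeq]
  exact ⟨BoundedContinuousFunction.mkOfCompact
    ⟨_, (LipschitzWith.of_dist_le_mul (K := ⟨K, hK.le⟩) hg).continuous⟩, hg, fun _ => rfl⟩

lemma exists_bellman_solution_of_finite {S U : Type*} [Finite S] [MeasurableSpace S]
    [MeasurableSingletonClass S] [Finite U] [Nonempty U] [MeasurableSpace U]
    (T : Kernel (S × U) S) [IsMarkovKernel T] (c : S → U → ℝ) {β : ℝ} (hβ0 : 0 ≤ β)
    (hβ1 : β < 1) :
    ∃ v : S → ℝ, ∀ x, v x = ⨅ u, (c x u + β * ∫ y, v y ∂T (x, u)) := by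
  let _ : TopologicalSpace S := ⊥
  have : DiscreteTopology S := ⟨rfl⟩
  have : OpensMeasurableSpace S := ⟨fun s _ => s.toFinite.measurableSet⟩
  obtain ⟨v, -, hv⟩ := exists_bellman_fixedPoint T c hβ0 hβ1 isClosed_univ ⟨0, trivial⟩
    fun f _ => ⟨BoundedContinuousFunction.mkOfCompact
      ⟨fun x => ⨅ u, (c x u + β * ∫ y, f y ∂T (x, u)), continuous_of_discreteTopology⟩,
      trivial, fun _ => rfl⟩
  exact ⟨v, hv⟩

lemma bellmanGap_nonneg {X U : Type*} [MeasurableSpace X] [MeasurableSpace U] [Finite U]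
    {T : Kernel (X × U) X} {c : X → U → ℝ} {β : ℝ} {v : X → ℝ}
    (hv : ∀ x, v x = ⨅ u, (c x u + β * ∫ y, v y ∂T (x, u))) (p : X × U) :
    0 ≤ bellmanGap T c β v p := by
  rw [bellmanGap, hv p.1]
  exact sub_nonneg.2 (ciInf_le (Set.finite_range fun u =>
    c p.1 u + β * ∫ y, v y ∂T (p.1, u)).bddBelow p.2)

/-! ### The finite-state model -/

namespace Quantization

variable {X U : Type*} [MeasurableSpace X] [MeasurableSpace U] [Finite U]
  [MeasurableSingletonClass U] {M : ℕ} (Q : Quantization X M)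

/-- A transition of the finite-state model draws `x` from the weight on the bin, moves according
to `T (· | x, u)` and quantizes the result. -/
lemma integral_finiteKernel (T : Kernel (X × U) X) [IsMarkovKernel T] (g : Fin M → ℝ) (i : Fin M)
    (u : U) :
    ∫ j, g j ∂(Q.finiteKernel T (i, u))
      = ∫ x, ∫ y, g (Q.index y) ∂T (x, u) ∂(Q.binMeasure i) := by
  have hmk : Measurable fun x : X => (x, u) := measurable_prodMk_right
  have hbind : Q.finiteKernel T (i, u)
      = (Q.binMeasure i).bind ((T.map Q.index).comap (fun x => (x, u)) hmk) := by
    refine Measure.ext_of_singleton fun j => ?_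
    rw [Measure.bind_apply (measurableSet_singleton j) (Kernel.aemeasurable _)]
    have h1 : Q.finiteKernel T (i, u) {j} = Q.finiteProb T i u j := by
      change (∑ k, Q.finiteProb T i u k • Measure.dirac k) {j} = _
      rw [Measure.finsetSum_apply, Finset.sum_eq_single j]
      · simp
      · intro k _ hk
        simp [hk]
      · simp
    rw [h1, finiteProb]
    refine lintegral_congr fun x => ?_
    rw [Kernel.comap_apply, Kernel.map_apply' _ Q.measurable_index _ (measurableSet_singleton j)]
    congr 1
    ext y
    exact (Q.index_eq_iff y j).symm
  rw [hbind, integral_bind_kernel]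
  · refine integral_congr_ae (Filter.Eventually.of_forall fun x => ?_)
    simp only [Kernel.comap_apply]
    rw [Kernel.map_apply _ Q.measurable_index, integral_map Q.measurable_index.aemeasurable
      (measurable_of_countable g).aestronglyMeasurable]
  · rw [← hbind]
    exact Integrable.of_finite

/-- A function that stays within `ε` of `a` on a bin has average within `ε` of `a` there. -/
lemma abs_integral_binMeasure_sub_le {h : X → ℝ} {i : Fin M} (hi : Integrable h (Q.binMeasure i))
    {a ε : ℝ} (hε : ∀ x ∈ Q.bin i, |h x - a| ≤ ε) : |∫ x, h x ∂(Q.binMeasure i) - a| ≤ ε := by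
  have ha : ∫ x, (h x - a) ∂(Q.binMeasure i) = ∫ x, h x ∂(Q.binMeasure i) - a := by
    rw [integral_sub hi (integrable_const a)]
    simp
  rw [← ha]
  have hae : ∀ᵐ x ∂(Q.binMeasure i), ‖h x - a‖ ≤ ε := by
    filter_upwards [ae_cond_mem (μ := Q.weight) (Q.measurableSet_bin i)] with x hx
    exact hε x hx
  simpa using norm_integral_le_of_norm_le_const hae

end Quantization

/-- The one-step lookahead costs of the finite-state model and of the original model differ by at
most `K * maxDiam + β * e`, where `e` bounds the distance between the two value functions. -/
lemma Quantization.abs_finite_lookahead_sub_le {X U : Type*} [MetricSpace X] [CompactSpace X]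
    [MeasurableSpace X] [BorelSpace X] [Finite U] [MeasurableSpace U] [MeasurableSingletonClass U]
    (T : Kernel (X × U) X) [IsMarkovKernel T] {c : X → U → ℝ} {β αc αT K e C B : ℝ} (hβ0 : 0 ≤ β)
    (hαT : 0 ≤ αT) (hK : 0 < K) (hKeq : αc + β * αT * K = K)
    (hcm : Measurable (Function.uncurry c)) (hcb : ∀ x u, |c x u| ≤ C)
    (hc : ∀ (x x' : X) (u : U), |c x u - c x' u| ≤ αc * dist x x')
    (hT : ∀ (x x' : X) (u : U),
      wasserstein1 (T (x, u)) (T (x', u)) ≤ ENNReal.ofReal (αT * dist x x'))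
    {M : ℕ} (Q : Quantization X M) {v : X → ℝ} (hvb : ∀ x, |v x| ≤ B)
    (hv : ∀ x y, |v x - v y| ≤ K * dist x y) {g : Fin M → ℝ}
    (he : ∀ x, |g (Q.index x) - v x| ≤ e) (x : X) (u : U) :
    |Q.finiteCost c (Q.index x) u + β * ∫ j, g j ∂(Q.finiteKernel T (Q.index x, u))
      - (c x u + β * ∫ y, v y ∂T (x, u))| ≤ K * Q.maxDiam + β * e := by
  have hvm : Measurable v :=
    (LipschitzWith.of_dist_le_mul (K := ⟨K, hK.le⟩) hv).continuous.measurable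
  have hgm : Measurable fun y => g (Q.index y) := (measurable_of_countable g).comp Q.measurable_index
  have hgb : ∀ y, |g (Q.index y)| ≤ e + B := fun y => by
    have h1 := abs_add_le (g (Q.index y) - v y) (v y)
    rw [sub_add_cancel] at h1
    linarith [he y, hvb y]
  have hmk : Measurable fun x : X => (x, u) := measurable_prodMk_right
  have i1 : Integrable (fun x => c x u) (Q.binMeasure (Q.index x)) :=
    integrable_of_measurable_of_bound _ (hcm.comp hmk) fun x => hcb x u
  have i2 : Integrable (fun x => β * ∫ y, g (Q.index y) ∂T (x, u)) (Q.binMeasure (Q.index x)) :=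
    (integrable_of_measurable_of_bound _
      (hgm.stronglyMeasurable.integral_kernel.measurable.comp hmk) fun x =>
        abs_integral_le_of_bound (T (x, u)) hgb).const_mul β
  rw [Quantization.finiteCost, Q.integral_finiteKernel, ← integral_const_mul,
    ← integral_add i1 i2]
  refine Q.abs_integral_binMeasure_sub_le (i1.add i2) fun x' hx' => ?_
  have hd : dist x' x ≤ Q.maxDiam :=
    (Metric.dist_le_diam_of_mem (Metric.isBounded_of_compactSpace) hx' (Q.mem_bin_index x)).trans
      (le_ciSup (Set.finite_range fun i => Metric.diam (Q.bin i)).bddAbove (Q.index x))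
  have h1 := abs_integral_sub_integral_le_of_wasserstein1_le
    (mul_nonneg hαT dist_nonneg) (hT x' x u) hK ⟨B, hvb⟩ hv
  have h2 : |∫ y, g (Q.index y) ∂T (x', u) - ∫ y, v y ∂T (x', u)| ≤ e := by
    rw [← integral_sub (integrable_of_measurable_of_bound _ hgm hgb)
      (integrable_of_measurable_of_bound _ hvm hvb)]
    exact abs_integral_le_of_bound _ he
  have h3 := hc x' x u
  have h4 : |(∫ y, g (Q.index y) ∂T (x', u)) - ∫ y, v y ∂T (x, u)|
      ≤ e + K * (αT * dist x' x) :=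
    (abs_sub_le _ (∫ y, v y ∂T (x', u)) _).trans (add_le_add h2 h1)
  calc |c x' u + β * ∫ y, g (Q.index y) ∂T (x', u) - (c x u + β * ∫ y, v y ∂T (x, u))|
      = |(c x' u - c x u) + β * (∫ y, g (Q.index y) ∂T (x', u) - ∫ y, v y ∂T (x, u))| := by
        congr 1; ring
    _ ≤ |c x' u - c x u| + β * |∫ y, g (Q.index y) ∂T (x', u) - ∫ y, v y ∂T (x, u)| := by
        refine (abs_add_le _ _).trans_eq ?_
        rw [abs_mul, abs_of_nonneg hβ0]
    _ ≤ αc * dist x' x + β * (e + K * (αT * dist x' x)) := by gcongr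
    _ = (αc + β * αT * K) * dist x' x + β * e := by ring
    _ ≤ K * Q.maxDiam + β * e := by rw [hKeq]; gcongr

/-- In a finite model, the action that an optimal stationary policy takes in a state attains the
minimum in the Bellman equation there. -/
lemma IsOptimalPolicy.eq_lookahead {S U : Type*} [Finite S] [MeasurableSpace S]
    [MeasurableSingletonClass S] [Finite U] [Nonempty U] [MeasurableSpace U]
    [MeasurableSingletonClass U] {T : Kernel (S × U) S} [IsMarkovKernel T] {c : S → U → ℝ} {β : ℝ}
    (hβ0 : 0 ≤ β) (hβ1 : β < 1) {f : S → U} {hf : Measurable f} (h : IsOptimalPolicy T c β f hf)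
    {v : S → ℝ} (hv : ∀ x, v x = ⨅ u, (c x u + β * ∫ y, v y ∂T (x, u))) (x : S) :
    v x = c x (f x) + β * ∫ y, v y ∂T (x, f x) := by
  obtain ⟨C, hC⟩ := (Set.finite_range fun p : S × U => |c p.1 p.2|).bddAbove
  obtain ⟨B, hB⟩ := (Set.finite_range fun x => |v x|).bddAbove
  have hcb : ∀ x u, |c x u| ≤ C := fun x u => hC ⟨(x, u), rfl⟩
  have hvb : ∀ x, |v x| ≤ B := fun x => hB ⟨x, rfl⟩
  have hcm : Measurable (Function.uncurry c) := measurable_of_countable _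
  have hvm : Measurable v := measurable_of_countable _
  have hgap : ∀ p, 0 ≤ bellmanGap T c β v p := bellmanGap_nonneg hv
  -- a greedy policy attains `v`, so the optimal cost is at most `v`
  have hgreedy : ∀ x, ∃ u, c x u + β * ∫ y, v y ∂T (x, u) = v x := fun x => by
    rw [hv x]
    exact exists_eq_ciInf_of_finite
  choose k hk using hgreedy
  have hkm : Measurable k := measurable_of_countable k
  have hle : discountedCost T c β x (stationary k hkm) ≤ v x := by
    simpa using discountedCost_stationary_le T hβ0 hβ1 hcm hcb hvm hvb hkm le_rfl
      (fun x => (sub_eq_zero.2 (hk x)).le) x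
  have hbdd : BddBelow (Set.range fun γ => discountedCost T c β x γ) :=
    ⟨v x, by
      rintro _ ⟨γ, rfl⟩
      exact le_discountedCost_of_bellmanGap_nonneg T hβ0 hβ1 hcm hcb hvm hvb hgap γ x⟩
  have hopt : discountedCost T c β x (stationary f hf) ≤ v x :=
    (h x).trans_le ((ciInf_le hbdd _).trans hle)
  have h0 := bellmanGap_nonpos_of_discountedCost_le T hβ0 hβ1 hcm hcb hvm hvb hgap hf hopt
  have h1 := hgap (x, f x)
  simp only [bellmanGap] at h0 h1
  linarith

end QuantizedMDP

/-! ### The error bound -/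

theorem theorem6 {X U : Type*}
    [MetricSpace X] [CompactSpace X] [MeasurableSpace X] [BorelSpace X]
    [Finite U] [Nonempty U] [MeasurableSpace U] [MeasurableSingletonClass U]
    (T : Kernel (X × U) X) [IsMarkovKernel T] (c : X → U → ℝ)
    (β αc αT : ℝ) (hβ0 : 0 < β) (hβ1 : β < 1) (hαc : 0 < αc) (hαT : 0 < αT)
    (hβαT : β * αT < 1)
    (hc : ∀ (x x' : X) (u : U), |c x u - c x' u| ≤ αc * dist x x')
    (hT : ∀ (x x' : X) (u : U),
      QuantizedMDP.wasserstein1 (T (x, u)) (T (x', u)) ≤ ENNReal.ofReal (αT * dist x x'))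
    (M : ℕ) (Q : QuantizedMDP.Quantization X M)
    (γhat : Fin M → U)
    (hγhat : QuantizedMDP.IsOptimalPolicy (Q.finiteKernel T) (Q.finiteCost c) β γhat
      (measurable_of_countable γhat)) :
    ∀ x₀ : X,
      |QuantizedMDP.discountedCost T c β x₀ (Q.extend γhat) -
          QuantizedMDP.optimalCost T c β x₀| ≤
        2 * αc / ((1 - β) ^ 2 * (1 - β * αT)) * Q.maxDiam := by
  intro x₀
  open QuantizedMDP in
  have hβ1' : 0 < 1 - β := sub_pos.2 hβ1
  have hβαT' : 0 < 1 - β * αT := sub_pos.2 hβαT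
  -- `K` is the Lipschitz constant of the value function
  obtain ⟨K, hKdef⟩ : ∃ K, K = αc / (1 - β * αT) := ⟨_, rfl⟩
  have hK : 0 < K := hKdef ▸ div_pos hαc hβαT'
  have hKeq : αc + β * αT * K = K := by
    rw [hKdef]
    field_simp
    ring
  have hcm : Measurable (Function.uncurry c) := measurable_from_prod_countable_left fun u =>
    (LipschitzWith.of_dist_le_mul (K := ⟨αc, hαc.le⟩) fun x x' => hc x x' u).continuous.measurable
  obtain ⟨C₀, hC₀⟩ := (Set.finite_range fun u => |c x₀ u|).bddAbove
  have hcb : ∀ x u, |c x u| ≤ C₀ + αc * Metric.diam (Set.univ : Set X) := fun x u => by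
    have h1 := abs_add_le (c x₀ u) (c x u - c x₀ u)
    rw [add_sub_cancel] at h1
    have h2 : dist x x₀ ≤ Metric.diam (Set.univ : Set X) :=
      Metric.dist_le_diam_of_mem Metric.isBounded_of_compactSpace trivial trivial
    have h3 := mul_le_mul_of_nonneg_left h2 hαc.le
    have h4 : |c x₀ u| ≤ C₀ := hC₀ ⟨u, rfl⟩
    linarith [hc x x₀ u]
  -- the value functions `v` of the original and `g` of the finite-state model
  obtain ⟨v, hvL, hv⟩ :=
    exists_lipschitz_bellman_solution T hβ0.le hβ1 hαT.le hK hKeq hc hT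
  have hvb : ∀ x, |v x| ≤ ‖v‖ := v.norm_coe_le_norm
  have hvm : Measurable v := v.continuous.measurable
  obtain ⟨g, hg⟩ :=
    exists_bellman_solution_of_finite (Q.finiteKernel T) (Q.finiteCost c) hβ0.le hβ1
  obtain ⟨B, hB⟩ := (Set.finite_range fun i => |g i|).bddAbove
  have hebdd : BddAbove (Set.range fun x => |g (Q.index x) - v x|) := by
    refine ⟨B + ‖v‖, ?_⟩
    rintro _ ⟨x, rfl⟩
    exact (abs_sub _ _).trans (add_le_add (hB ⟨_, rfl⟩) (hvb x))
  obtain ⟨e, hedef⟩ : ∃ e, e = ⨆ x, |g (Q.index x) - v x| := ⟨_, rfl⟩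
  have he : ∀ x, |g (Q.index x) - v x| ≤ e := fun x => hedef ▸ le_ciSup hebdd x
  have he0 : 0 ≤ e := (abs_nonneg _).trans (he x₀)
  have hstep := Q.abs_finite_lookahead_sub_le T hβ0.le hαT.le hK hKeq hcm hcb hc hT hvb hvL he
  have hee : e ≤ K * Q.maxDiam + β * e := by
    have : Nonempty X := ⟨x₀⟩
    rw [hedef]
    refine ciSup_le fun x => ?_
    rw [← hedef, hg, hv]
    exact abs_iInf_sub_iInf_le fun u => hstep x u
  have hgap : ∀ p, 0 ≤ bellmanGap T c β v p := bellmanGap_nonneg hv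
  -- `γhat` is nearly greedy for `v`, since it is greedy for `g`
  have hnear : ∀ x, bellmanGap T c β v (x, γhat (Q.index x)) ≤ K * Q.maxDiam + β * e + e := by
    intro x
    have h1 := (abs_le.1 (hstep x (γhat (Q.index x)))).1
    have h2 := (abs_le.1 (he x)).2
    rw [← hγhat.eq_lookahead hβ0.le hβ1 hg] at h1
    simp only [bellmanGap]
    linarith
  have hupper : discountedCost T c β x₀ (Q.extend γhat)
      ≤ v x₀ + (K * Q.maxDiam + β * e + e) / (1 - β) :=
    discountedCost_stationary_le T hβ0.le hβ1 hcm hcb hvm hvb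
      ((measurable_of_countable γhat).comp Q.measurable_index) (by linarith) hnear x₀
  have hlower : ∀ γ, v x₀ ≤ discountedCost T c β x₀ γ := fun γ =>
    le_discountedCost_of_bellmanGap_nonneg T hβ0.le hβ1 hcm hcb hvm hvb hgap γ x₀
  have hopt_ge : v x₀ ≤ optimalCost T c β x₀ :=
    have : Nonempty (AdmissiblePolicy X U) := ⟨Q.extend γhat⟩
    le_ciInf hlower
  have hopt_le : optimalCost T c β x₀ ≤ discountedCost T c β x₀ (Q.extend γhat) :=
    ciInf_le ⟨v x₀, by rintro _ ⟨γ, rfl⟩; exact hlower γ⟩ _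
  have hnum : K * Q.maxDiam + β * e + e ≤ 2 * (K * Q.maxDiam) / (1 - β) := by
    rw [le_div_iff₀ hβ1']
    -- the difference of the two sides is `1 + β` times the slack in `hee`
    linarith [mul_le_mul_of_nonneg_left hee (by linarith : 0 ≤ 1 + β)]
  have hconst : 2 * (K * Q.maxDiam) / (1 - β) / (1 - β)
      = 2 * αc / ((1 - β) ^ 2 * (1 - β * αT)) * Q.maxDiam := by
    rw [hKdef]
    field_simp
  rw [abs_of_nonneg (sub_nonneg.2 hopt_le), ← hconst]
  linarith [div_le_div_of_nonneg_right hnum hβ1'.le]
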